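/- **Conventions.** Formulas are built from an infinite set of variables by the connectives $\wedge,\vee,\top,\bot,-$. A logic is a relation $\Gamma\vdash\varphi$ between sets of formulas and formulas which is reflexive, monotone, closed under cut and closed under substitutions; it is finitary if $\Gamma\vdash\varphi$ implies $\Gamma'\vdash\varphi$ for some finite $\Gamma'\subseteq\Gamma$. Let $\mathbf{DM}_4$ be the four-element De Morgan algebra $\{\top,\bot,\mathsf n,\mathsf b\}$, with $\mathsf n,\mathsf b$ incomparable and $-\mathsf n=\mathsf n$, $-\mathsf b=\mathsf b$. Belnap–Dunn logic $\mathcal{BD}$ is the logic of the matrix $\langle\mathbf{DM}_4,\{\top,\mathsf b\}\rangle$, and Exactly True Logic $\mathcal{ETL}$ is the logic of the matrix $\langle\mathbf{DM}_4,\{\top\}\rangle$ (a rule is valid if each valuation which designates all premises designates the conclusion). A super-Belnap logic is an extension of $\mathcal{BD}$. An explosive rule $\Gamma\vdash\emptyset$ states that $\Gamma$ is inconsistent, i.e. it is the rule $\Gamma\vdash\bot$. The extension of a logic by a set of rules is the least logic which extends it and validates these rules; an explosive extension is an extension by a set of explosive rules. Graphs are finite, with a symmetric edge relation, loops allowed.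 For a non-empty graph $G=\langle X,R\rangle$ without isolated vertices put $$\varphi_G=\bigvee_{u\in X}\Bigl(p_u\wedge\bigwedge_{v\in X,\ \neg uRv}-p_v\Bigr).$$ A lower bound of a family of graphs is a non-empty graph which admits a homomorphism into each graph of the family. De Morgan algebras are bounded distributive lattices with an order-inverting involution, in the signature $\wedge,\vee,\top,\bot,-$. An antivariety (quasivariety) of De Morgan algebras is a class of De Morgan algebras axiomatized, among De Morgan algebras, by a set of universally quantified negative clauses $t_1\not\approx u_1\vee\dots\vee t_n\not\approx u_n$ (quasiequations $t_1\approx u_1\,\&\,\dots\,\&\,t_n\approx u_n\Rightarrow t\approx u$). An infinitary negative clause is such a disjunction over a possibly infinite set of inequations. A prevariety is a class closed under isomorphic copies, subalgebras and arbitrary direct products. **Proposition.** 1. There is a super-Belnap logic which is an explosive extension of $\mathcal{ETL}$ and which is not finitary. 2. More precisely, there is a countable family $(G_n)_{n\in\mathbb N}$ of non-empty graphs without isolated vertices such that no finite subfamily has the same lower bounds as the whole family. For each such family, if the formulas $\varphi_{G_n}$ are written in pairwise disjoint sets of variables (distinct vertices being assigned distinct variables), then the extension of $\mathcal{ETL}$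 by the single explosive rule $\{\varphi_{G_n}\mid n\in\mathbb N\}\vdash\emptyset$ is the intersection over $n\in\mathbb N$ of the extensions of $\mathcal{ETL}$ by the rules $\varphi_{G_n}\vdash\emptyset$, and it is not finitary. 3. There is a class of De Morgan algebras axiomatized, among De Morgan algebras, by an infinitary negative clause which is not an antivariety of De Morgan algebras. 4. There is a prevariety of De Morgan algebras which is not a quasivariety. -/

import Mathlib

universe u w

namespace SuperBelnap

/-! Formulas, which are also the terms in the signature of De Morgan algebras. -/

/-- Formulas over the set of variables `Var` in the signature `∧, ∨, ⊤, ⊥, -`. -/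
inductive Fm (Var : Type u) : Type u
  | var : Var → Fm Var
  | top : Fm Var
  | bot : Fm Var
  | neg : Fm Var → Fm Var
  | and : Fm Var → Fm Var → Fm Var
  | or : Fm Var → Fm Var → Fm Var

/-- The substitution instance of a formula. -/
def Fm.subst {Var : Type u} {Var' : Type w} (σ : Var → Fm Var') : Fm Var → Fm Var'
  | .var p => σ p
  | .top => .top
  | .bot => .bot
  | .neg φ => .neg (φ.subst σ)
  | .and φ ψ => .and (φ.subst σ) (ψ.subst σ)
  | .or φ ψ => .or (φ.subst σ) (ψ.subst σ)

/-- The conjunction of a list of formulas. -/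
def Fm.bigAnd {Var : Type u} (l : List (Fm Var)) : Fm Var := l.foldr Fm.and Fm.top

/-- The disjunction of a list of formulas. -/
def Fm.bigOr {Var : Type u} (l : List (Fm Var)) : Fm Var := l.foldr Fm.or Fm.bot

/-! De Morgan algebras. -/

/-- A De Morgan algebra: a bounded distributive lattice with an order-inverting involution. -/
class DeMorganAlgebra (A : Type w) extends DistribLattice A, BoundedOrder A where
  dneg : A → A
  dneg_dneg : ∀ a : A, dneg (dneg a) = a
  dneg_sup : ∀ a b : A, dneg (a ⊔ b) = dneg a ⊓ dneg b

open DeMorganAlgebra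

/-- The value of a formula under the valuation determined by the values `v` of the variables. -/
def Fm.eval {Var : Type u} {A : Type w} [DeMorganAlgebra A] (v : Var → A) : Fm Var → A
  | .var p => v p
  | .top => ⊤
  | .bot => ⊥
  | .neg φ => dneg (φ.eval v)
  | .and φ ψ => φ.eval v ⊓ ψ.eval v
  | .or φ ψ => φ.eval v ⊔ ψ.eval v

theorem Fm.eval_subst {Var : Type u} {A : Type w} [DeMorganAlgebra A] (v : Var → A)
    (σ : Var → Fm Var) (φ : Fm Var) :
    (φ.subst σ).eval v = φ.eval (fun p => (σ p).eval v) := by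
  induction φ <;> simp_all [Fm.subst, Fm.eval]

/-- The four-element diamond whose involution has two fixpoints, `(true, false)` and
`(false, true)`. -/
abbrev DM4 : Type := Bool × Bool

instance : DeMorganAlgebra DM4 where
  dneg a := (!a.2, !a.1)
  dneg_dneg := by decide
  dneg_sup := by decide

/-- The direct product of a family of De Morgan algebras. -/
instance {I : Type w} (A : I → Type w) [∀ i, DeMorganAlgebra (A i)] :
    DeMorganAlgebra (∀ i, A i) where
  dneg a := fun i => dneg (a i)
  dneg_dneg a := funext fun i => dneg_dneg (a i)
  dneg_sup a b := funext fun i => dneg_sup (a i) (b i)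

/-- Homomorphisms of De Morgan algebras. -/
structure IsDMHom {A B : Type w} [DeMorganAlgebra A] [DeMorganAlgebra B] (f : A → B) : Prop where
  map_inf : ∀ a b, f (a ⊓ b) = f a ⊓ f b
  map_sup : ∀ a b, f (a ⊔ b) = f a ⊔ f b
  map_top : f ⊤ = ⊤
  map_bot : f ⊥ = ⊥
  map_dneg : ∀ a, f (dneg a) = dneg (f a)

/-! Logics. -/

/-- A logic over the variables `Var`: a reflexive, monotone and structural consequence relation
satisfying cut. -/
@[ext]
structure Logic (Var : Type u) where
  Entails : Set (Fm Var) → Fm Var → Prop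
  refl : ∀ φ, Entails {φ} φ
  mono : ∀ Γ Δ φ, Entails Γ φ → Entails (Γ ∪ Δ) φ
  cut : ∀ Γ Δ φ, (∀ δ ∈ Δ, Entails Γ δ) → Entails Δ φ → Entails Γ φ
  structural : ∀ Γ φ (σ : Var → Fm Var), Entails Γ φ → Entails (Fm.subst σ '' Γ) (φ.subst σ)

namespace Logic

variable {Var : Type u}

/-- `B ≤ L` means that `L` is an extension of `B`. -/
instance : LE (Logic Var) := ⟨fun B L => ∀ Γ φ, B.Entails Γ φ → L.Entails Γ φ⟩

/-- The intersection of a set of logics. -/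
instance : InfSet (Logic Var) := ⟨fun S =>
  { Entails := fun Γ φ => ∀ L ∈ S, L.Entails Γ φ
    refl := fun φ L _ => L.refl φ
    mono := fun Γ Δ φ h L hL => L.mono Γ Δ φ (h L hL)
    cut := fun Γ Δ φ h h' L hL => L.cut Γ Δ φ (fun δ hδ => h δ hδ L hL) (h' L hL)
    structural := fun Γ φ σ h L hL => L.structural Γ φ σ (h L hL) }⟩

/-- A logic is finitary if each valid rule is already valid for finitely many of its premises. -/
def IsFinitary (L : Logic Var) : Prop :=
  ∀ Γ φ, L.Entails Γ φ → ∃ Γ' : Set (Fm Var), Γ' ⊆ Γ ∧ Γ'.Finite ∧ L.Entails Γ' φ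

/-- The extension of `B` by a set of rules `Γ ⊢ φ`: the least logic which extends `B` and
validates the rules. -/
def extendBy (B : Logic Var) (ρ : Set (Set (Fm Var) × Fm Var)) : Logic Var :=
  sInf {L | B ≤ L ∧ ∀ r ∈ ρ, L.Entails r.1 r.2}

/-- The extension of `B` by the explosive rules `Γ ⊢ ∅` for `Γ ∈ D`. Since all logics here have
the constant `⊥` with `⊥ ⊢ φ` for each `φ`, the rule `Γ ⊢ ∅` is taken in the form `Γ ⊢ ⊥`
(see `entails_bot_iff`). -/
def explosiveExtendBy (B : Logic Var) (D : Set (Set (Fm Var))) : Logic Var :=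
  B.extendBy {r | r.1 ∈ D ∧ r.2 = Fm.bot}

/-- `L` is an explosive extension of `B` if it is the extension of `B` by some set of
explosive rules. -/
def IsExplosiveExtension (B L : Logic Var) : Prop :=
  ∃ D : Set (Set (Fm Var)), L = B.explosiveExtendBy D

/-- The logic determined by the matrix with the algebra `A` and the designated values `F`. -/
def ofMatrix (Var : Type u) {A : Type w} [DeMorganAlgebra A] (F : Set A) : Logic Var where
  Entails Γ φ := ∀ v : Var → A, (∀ γ ∈ Γ, γ.eval v ∈ F) → φ.eval v ∈ F
  refl φ v h := h φ rfl
  mono Γ Δ φ h v hv := h v fun γ hγ => hv γ (Or.inl hγ)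
  cut Γ Δ φ h h' v hv := h' v fun δ hδ => h δ hδ v hv
  structural Γ φ σ h v hv := by
    rw [Fm.eval_subst]
    refine h _ fun γ hγ => ?_
    rw [← Fm.eval_subst]
    exact hv _ ⟨γ, hγ, rfl⟩

/-- Belnap--Dunn logic: the designated values are the top and one of the two fixpoints. -/
def BD (Var : Type u) : Logic Var := ofMatrix Var {a : DM4 | a.1 = true}

/-- Exactly True Logic: only the top value is designated. -/
def ETL (Var : Type u) : Logic Var := ofMatrix Var {(⊤ : DM4)}

/-- In a super-Belnap logic, `Γ ⊢ ⊥` holds if and only if each substitution instance of `Γ`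
entails each formula, i.e. if and only if `Γ` is an antitheorem. -/
theorem entails_bot_iff (L : Logic Var) (hL : BD Var ≤ L) (Γ : Set (Fm Var)) :
    L.Entails Γ Fm.bot ↔ ∀ (σ : Var → Fm Var) (φ : Fm Var), L.Entails (Fm.subst σ '' Γ) φ := by
  constructor
  · intro h σ φ
    refine L.cut _ {Fm.bot} φ ?_ (hL _ _ ?_)
    · rintro δ rfl
      exact L.structural Γ _ σ h
    · intro v hv
      have := hv _ rfl
      simp [Fm.eval] at this
  · intro h
    have hid : ∀ φ : Fm Var, φ.subst Fm.var = φ := by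
      intro φ
      induction φ <;> simp_all [Fm.subst]
    have := h Fm.var Fm.bot
    rwa [show Fm.subst (Fm.var : Var → Fm Var) = id from funext hid, Set.image_id] at this

end Logic

/-! Finite graphs with loops allowed, and the explosive rules associated with them. -/

/-- A finite symmetric graph with loops allowed, with vertices `0, …, size - 1`. -/
structure FinGraph where
  size : ℕ
  Adj : Fin size → Fin size → Prop
  symm : ∀ a b, Adj a b → Adj b a

namespace FinGraph

/-- There is a homomorphism from `G` to `H`. -/
def HomTo (G H : FinGraph) : Prop :=
  ∃ f : Fin G.size → Fin H.size, ∀ a b, G.Adj a b → H.Adj (f a) (f b)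

/-- A non-empty graph without isolated vertices (a vertex with a loop is its own neighbor). -/
def Admissible (G : FinGraph) : Prop := 0 < G.size ∧ ∀ a, ∃ b, G.Adj a b

/-- The non-empty graphs which lie below each graph of `K` in the homomorphism order. -/
def lowerBounds (K : Set FinGraph) : Set FinGraph := {H | 0 < H.size ∧ ∀ G ∈ K, H.HomTo G}

open Classical in
/-- The formula `φ_G`, i.e. the disjunction over the vertices `a` of `G` of
`p_a ∧ ⋀ {- p_b | b is not adjacent to a}`, where `p_a` is the variable `x a`. -/
noncomputable def formula {Var : Type u} (G : FinGraph) (x : Fin G.size → Var) : Fm Var :=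
  Fm.bigOr ((List.finRange G.size).map fun a =>
    Fm.and (Fm.var (x a))
      (Fm.bigAnd (((List.finRange G.size).filter fun b => ¬ G.Adj a b).map fun b =>
        Fm.neg (Fm.var (x b)))))

end FinGraph

/-- A sequence of non-empty graphs without isolated vertices such that no finite subfamily has the
same lower bounds in the homomorphism order as the whole family. -/
def NoFiniteSubfamily (G : ℕ → FinGraph) : Prop :=
  (∀ n, (G n).Admissible) ∧
    ∀ S : Set ℕ, S.Finite →
      FinGraph.lowerBounds (G '' S) ≠ FinGraph.lowerBounds (Set.range G)

/-! Classes of De Morgan algebras. -/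

/-- Classes of De Morgan algebras. -/
def DMClass : Type (w + 1) := ∀ A : Type w, DeMorganAlgebra A → Prop

/-- Equations `t ≈ u` between terms in the variables indexed by natural numbers. -/
abbrev Equation : Type := Fm ℕ × Fm ℕ

/-- The equation holds in `A` under the valuation `v`. -/
def Equation.Holds {A : Type w} [DeMorganAlgebra A] (v : ℕ → A) (e : Equation) : Prop :=
  e.1.eval v = e.2.eval v

/-- The (possibly infinitary) negative clause which is the disjunction of the negations of the
equations in `E` is valid in `A`. -/
def SatNegClause (A : Type w) [DeMorganAlgebra A] (E : Set Equation) : Prop :=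
  ∀ v : ℕ → A, ∃ e ∈ E, ¬ e.Holds v

/-- The quasiequation with the premises `E` and the conclusion `e` is valid in `A`. -/
def SatQuasiEq (A : Type w) [DeMorganAlgebra A] (E : Finset Equation) (e : Equation) : Prop :=
  ∀ v : ℕ → A, (∀ e' ∈ E, e'.Holds v) → e.Holds v

/-- The class of De Morgan algebras axiomatized by the negative clause given by `E`. -/
def negClauseClass (E : Set Equation) : DMClass.{w} := fun A _ => SatNegClause A E

/-- An antivariety of De Morgan algebras: a class axiomatized among De Morgan algebras by a set of
finitary negative clauses. -/
def IsAntivariety (C : DMClass.{w}) : Prop :=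
  ∃ T : Set (Finset Equation), ∀ (A : Type w) (hA : DeMorganAlgebra A),
    C A hA ↔ ∀ E ∈ T, SatNegClause A (E : Set Equation)

/-- A quasivariety of De Morgan algebras: a class axiomatized among De Morgan algebras by a set of
quasiequations. -/
def IsQuasivariety (C : DMClass.{w}) : Prop :=
  ∃ T : Set (Finset Equation × Equation), ∀ (A : Type w) (hA : DeMorganAlgebra A),
    C A hA ↔ ∀ r ∈ T, SatQuasiEq A r.1 r.2

/-- A prevariety of De Morgan algebras: a class closed under isomorphic copies of subalgebras
(i.e. algebras which embed into a member) and under direct products. -/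
structure IsPrevariety (C : DMClass.{w}) : Prop where
  embed : ∀ (A B : Type w) (hA : DeMorganAlgebra A) (hB : DeMorganAlgebra B) (f : B → A),
    IsDMHom f → Function.Injective f → C A hA → C B hB
  prod : ∀ (I : Type w) (A : I → Type w) (hA : ∀ i, DeMorganAlgebra (A i)),
    (∀ i, C (A i) (hA i)) → C (∀ i, A i) inferInstance

end SuperBelnap

namespace SuperBelnap

open DeMorganAlgebra

/-! Evaluation of formulas. -/

/-! Everything rests on one correspondence. A symmetric graph on `V` yields a De Morgan algebra
`upsets R` inside a power of `DM4`, and `φ_G` can take the value `⊤` in it exactly when there is a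
homomorphism from `⟨V, R⟩` to `G`: a valuation yields a homomorphism by
`exists_hom_of_eval_formula`, and a homomorphism yields `canonicalVal` (`eval_canonicalVal`).

In the extension of `ETL` by `Δ ⊢ ∅`, a set is explosive iff it entails an instance of `Δ` in `ETL`
(`explosiveExtendBy_singleton_entails`). For disjoint variables, the instances of the various `φ_{G
n}` can be glued together, which gives the intersection. If finitely many `φ_{G n}` were already
explosive, they would entail an instance of each `φ_{G m}`, so each common lower bound of these
finitely many graphs would lie below all `G m`, contrary to `NoFiniteSubfamily`. Odd cycles of
growing length are such a family.

For classes of algebras, take the product of the vertex sets and let stage `n` have only the edges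
which respect the coordinates up to `n`. The edge relations shrink, so the upset algebras grow. No
stage satisfies all equations `φ_{G m} ≈ ⊤` jointly, but their union does, through the projections.
A finitary condition which fails in the union fails at some stage, hence it cannot separate the
union from the stages. -/

theorem Fm.eval_pi {Var : Type u} {I : Type w} {A : I → Type w} [∀ i, DeMorganAlgebra (A i)]
    (v : Var → ∀ i, A i) (φ : Fm Var) (i : I) : φ.eval v i = φ.eval fun p => v p i := by
  induction φ with
  | var p => rfl
  | top => rfl
  | bot => rfl
  | neg φ ih => exact congrArg dneg ih
  | and φ ψ ih ih' => exact congrArg₂ _ ih ih'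
  | or φ ψ ih ih' => exact congrArg₂ _ ih ih'

theorem IsDMHom.eval {Var : Type u} {A B : Type w} [DeMorganAlgebra A] [DeMorganAlgebra B]
    {f : A → B} (hf : IsDMHom f) (v : Var → A) (φ : Fm Var) :
    f (φ.eval v) = φ.eval fun p => f (v p) := by
  induction φ <;>
    simp_all [Fm.eval, hf.map_inf, hf.map_sup, hf.map_top, hf.map_bot, hf.map_dneg]

theorem Fm.exists_eval_congr (φ : Fm ℕ) : ∃ N : ℕ, ∀ (A : Type w) (_ : DeMorganAlgebra A)
    (v v' : ℕ → A), (∀ k < N, v k = v' k) → φ.eval v = φ.eval v' := by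
  induction φ with
  | var p => exact ⟨p + 1, fun A _ v v' h => h p (Nat.lt_succ_self p)⟩
  | top => exact ⟨0, fun A _ v v' h => rfl⟩
  | bot => exact ⟨0, fun A _ v v' h => rfl⟩
  | neg φ ih =>
    obtain ⟨N, h⟩ := ih
    exact ⟨N, fun A _ v v' hv => congrArg dneg (h A _ v v' hv)⟩
  | and φ ψ ih ih' =>
    obtain ⟨N, h⟩ := ih
    obtain ⟨M, h'⟩ := ih'
    exact ⟨max N M, fun A _ v v' hv => congrArg₂ (· ⊓ ·)
      (h A _ v v' fun k hk => hv k (lt_max_of_lt_left hk))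
      (h' A _ v v' fun k hk => hv k (lt_max_of_lt_right hk))⟩
  | or φ ψ ih ih' =>
    obtain ⟨N, h⟩ := ih
    obtain ⟨M, h'⟩ := ih'
    exact ⟨max N M, fun A _ v v' hv => congrArg₂ (· ⊔ ·)
      (h A _ v v' fun k hk => hv k (lt_max_of_lt_left hk))
      (h' A _ v v' fun k hk => hv k (lt_max_of_lt_right hk))⟩

/-- Finitely many equations contain only finitely many variables. -/
theorem exists_holds_congr (E : Finset Equation) : ∃ N : ℕ, ∀ (A : Type w) (_ : DeMorganAlgebra A)
    (v v' : ℕ → A), (∀ k < N, v k = v' k) → ∀ e ∈ E, e.Holds v ↔ e.Holds v' := by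
  classical
  induction E using Finset.induction_on with
  | empty => exact ⟨0, by simp⟩
  | insert e E _ ih =>
    obtain ⟨N, hN⟩ := ih
    obtain ⟨M, hM⟩ := Fm.exists_eval_congr.{w} e.1
    obtain ⟨K, hK⟩ := Fm.exists_eval_congr.{w} e.2
    refine ⟨max N (max M K), fun A _ v v' hv e' he' => ?_⟩
    rcases Finset.mem_insert.1 he' with rfl | he'
    · rw [Equation.Holds, Equation.Holds,
        hM A _ v v' fun k hk => hv k (by simp [hk]), hK A _ v v' fun k hk => hv k (by simp [hk])]
    · exact hN A _ v v' (fun k hk => hv k (by simp [hk])) e' he'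

/-! ### Values of `φ_G` in `DM4`, coordinate by coordinate. -/

theorem Fm.eval_bigOr_fst {Var : Type u} (w : Var → DM4) (l : List (Fm Var)) :
    ((Fm.bigOr l).eval w).1 = true ↔ ∃ φ ∈ l, (φ.eval w).1 = true := by
  induction l <;> simp_all [Fm.bigOr, Fm.eval]

theorem Fm.eval_bigOr_snd {Var : Type u} (w : Var → DM4) (l : List (Fm Var)) :
    ((Fm.bigOr l).eval w).2 = true ↔ ∃ φ ∈ l, (φ.eval w).2 = true := by
  induction l <;> simp_all [Fm.bigOr, Fm.eval]

theorem Fm.eval_bigAnd_fst {Var : Type u} (w : Var → DM4) (l : List (Fm Var)) :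
    ((Fm.bigAnd l).eval w).1 = true ↔ ∀ φ ∈ l, (φ.eval w).1 = true := by
  induction l <;> simp_all [Fm.bigAnd, Fm.eval]

theorem Fm.eval_bigAnd_snd {Var : Type u} (w : Var → DM4) (l : List (Fm Var)) :
    ((Fm.bigAnd l).eval w).2 = true ↔ ∀ φ ∈ l, (φ.eval w).2 = true := by
  induction l <;> simp_all [Fm.bigAnd, Fm.eval]

/-- Each coordinate commutes with `∧` and `∨`, while negation crosses over to the other coordinate;
hence the negated variables contribute a condition on `.2`. -/
theorem FinGraph.eval_formula_fst {Var : Type u} (G : FinGraph) (x : Fin G.size → Var)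
    (w : Var → DM4) : ((G.formula x).eval w).1 = true ↔
      ∃ a, (w (x a)).1 = true ∧ ∀ b, ¬ G.Adj a b → (w (x b)).2 = false := by
  have inf_fst (s t : DM4) : (s ⊓ t).1 = true ↔ s.1 = true ∧ t.1 = true := by simp
  simp [FinGraph.formula, Fm.eval_bigOr_fst, Fm.eval, Fm.eval_bigAnd_fst, dneg, -Prod.fst_inf,
    inf_fst]

theorem FinGraph.eval_formula_snd {Var : Type u} (G : FinGraph) (x : Fin G.size → Var)
    (w : Var → DM4) : ((G.formula x).eval w).2 = true ↔
      ∃ a, (w (x a)).2 = true ∧ ∀ b, ¬ G.Adj a b → (w (x b)).1 = false := by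
  have inf_snd (s t : DM4) : (s ⊓ t).2 = true ↔ s.2 = true ∧ t.2 = true := by simp
  simp [FinGraph.formula, Fm.eval_bigOr_snd, Fm.eval, Fm.eval_bigAnd_snd, dneg, -Prod.snd_inf,
    inf_snd]

theorem DM4.eq_top_iff (a : DM4) : a = ⊤ ↔ a.1 = true ∧ a.2 = true := Prod.ext_iff

/-! Subalgebras of powers of the four-element diamond. -/

/-- Sets of functions which form a subalgebra of a power of `DM4`. -/
structure IsSubalgebra {V : Type w} (P : Set (V → DM4)) : Prop where
  top : (fun _ => ⊤) ∈ P
  bot : (fun _ => ⊥) ∈ P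
  neg : ∀ s ∈ P, (fun u => dneg (s u)) ∈ P
  inf : ∀ s ∈ P, ∀ t ∈ P, (fun u => s u ⊓ t u) ∈ P
  sup : ∀ s ∈ P, ∀ t ∈ P, (fun u => s u ⊔ t u) ∈ P

/-- The subalgebra as a De Morgan algebra. -/
abbrev IsSubalgebra.algebra {V : Type w} {P : Set (V → DM4)} (hP : IsSubalgebra P) :
    DeMorganAlgebra P :=
  letI : Max P := ⟨fun s t => ⟨_, hP.sup _ s.2 _ t.2⟩⟩
  letI : Min P := ⟨fun s t => ⟨_, hP.inf _ s.2 _ t.2⟩⟩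
  { Function.Injective.distribLattice (Subtype.val : P → V → DM4) Subtype.val_injective
      Iff.rfl Iff.rfl (fun _ _ => rfl) (fun _ _ => rfl) with
    top := ⟨_, hP.top⟩
    bot := ⟨_, hP.bot⟩
    le_top := fun s u => (le_top : s.1 u ≤ ⊤)
    bot_le := fun s u => (bot_le : ⊥ ≤ s.1 u)
    dneg := fun s => ⟨_, hP.neg _ s.2⟩
    dneg_dneg := fun s => Subtype.ext (funext fun u => dneg_dneg (s.1 u))
    dneg_sup := fun s t => Subtype.ext (funext fun u => dneg_sup (s.1 u) (t.1 u)) }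

theorem IsSubalgebra.eval_apply {Var : Type u} {V : Type w} {P : Set (V → DM4)}
    (hP : IsSubalgebra P) (v : Var → P) (φ : Fm Var) (u : V) :
    letI := hP.algebra
    (φ.eval v).1 u = φ.eval fun p => (v p).1 u := by
  induction φ with
  | var p => rfl
  | top => rfl
  | bot => rfl
  | neg φ ih => exact congrArg dneg ih
  | and φ ψ ih ih' => exact congrArg₂ (fun s t : DM4 => s ⊓ t) ih ih'
  | or φ ψ ih ih' => exact congrArg₂ (fun s t : DM4 => s ⊔ t) ih ih'

theorem IsSubalgebra.holds_iff {V : Type w} {P : Set (V → DM4)} (hP : IsSubalgebra P)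
    (v : ℕ → P) (e : Equation) :
    letI := hP.algebra
    e.Holds v ↔ ∀ u, e.Holds fun p => (v p).1 u := by
  let := hP.algebra
  simp only [Equation.Holds, ← hP.eval_apply]
  exact Subtype.ext_iff.trans funext_iff

/-- The functions which correspond to the upsets of the poset with involution which consists of two
copies of the graph `⟨V, R⟩`, with edges leading from the lower copy to the upper copy. -/
def upsets {V : Type w} (R : V → V → Prop) : Set (V → DM4) :=
  {s | ∀ a b, R a b → (s a).1 = true → (s b).2 = true}

/-- Negation turns the condition on an edge into its contrapositive on the reversed edge, so
symmetry of `R` is what makes the set closed under it. -/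
theorem isSubalgebra_upsets {V : Type w} {R : V → V → Prop} (hR : ∀ a b, R a b → R b a) :
    IsSubalgebra (upsets R) where
  top _ _ _ _ := rfl
  bot a b _ h := by simp at h
  neg s hs a b hab := by
    have := hs b a (hR a b hab)
    cases h : (s a).2 <;> simp_all [dneg]
  inf s hs t ht a b hab := by
    have := hs a b hab
    have := ht a b hab
    simp_all
  sup s hs t ht a b hab := by
    have := hs a b hab
    have := ht a b hab
    intro h
    rcases (by simpa using h : (s a).1 = true ∨ (t a).1 = true) with h | h <;> simp_all

/-- The union of an increasing sequence of subalgebras is a subalgebra. -/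
theorem isSubalgebra_iUnion {V : Type w} {P : ℕ → Set (V → DM4)} (hP : ∀ n, IsSubalgebra (P n))
    (hmono : Monotone P) : IsSubalgebra (⋃ n, P n) where
  top := Set.mem_iUnion.2 ⟨0, (hP 0).top⟩
  bot := Set.mem_iUnion.2 ⟨0, (hP 0).bot⟩
  neg s hs := by
    obtain ⟨n, hn⟩ := Set.mem_iUnion.1 hs
    exact Set.mem_iUnion.2 ⟨n, (hP n).neg s hn⟩
  inf s hs t ht := by
    obtain ⟨n, hn⟩ := Set.mem_iUnion.1 hs
    obtain ⟨m, hm⟩ := Set.mem_iUnion.1 ht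
    exact Set.mem_iUnion.2 ⟨max n m, (hP _).inf s (hmono (le_max_left n m) hn)
      t (hmono (le_max_right n m) hm)⟩
  sup s hs t ht := by
    obtain ⟨n, hn⟩ := Set.mem_iUnion.1 hs
    obtain ⟨m, hm⟩ := Set.mem_iUnion.1 ht
    exact Set.mem_iUnion.2 ⟨max n m, (hP _).sup s (hmono (le_max_left n m) hn)
      t (hmono (le_max_right n m) hm)⟩

theorem eval_mem_upsets {Var : Type u} {V : Type w} {R : V → V → Prop}
    (hR : ∀ a b, R a b → R b a) {v : V → Var → DM4} (hv : ∀ p, (fun a => v a p) ∈ upsets R)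
    (φ : Fm Var) : (fun a => φ.eval (v a)) ∈ upsets R := by
  let := (isSubalgebra_upsets hR).algebra
  let v' : Var → upsets R := fun p => ⟨_, hv p⟩
  have h : (φ.eval v').1 = fun a => φ.eval (v a) :=
    funext fun a => (isSubalgebra_upsets hR).eval_apply v' φ a
  exact h ▸ (φ.eval v').2

/-- A valuation in the algebra of upsets which makes `φ_G` true determines a homomorphism
into `G`. -/
theorem exists_hom_of_eval_formula {Var : Type u} {V : Type w} {R : V → V → Prop}
    (G : FinGraph) (x : Fin G.size → Var) (v : V → Var → DM4)
    (hv : ∀ p, (fun a => v a p) ∈ upsets R) (h : ∀ a, (G.formula x).eval (v a) = ⊤) :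
    ∃ f : V → Fin G.size, ∀ a b, R a b → G.Adj (f a) (f b) := by
  -- A disjunct true at `a` selects the vertex `f a`. Along an edge from `a` to `b`, `p_{f a}` is
  -- passed to the second coordinate at `b`, which rules out that `f b` and `f a` are non-adjacent.
  have h' := fun a => (G.eval_formula_fst x (v a)).1 (by rw [h a]; rfl)
  choose f hf hf' using h'
  refine ⟨f, fun a b hab => ?_⟩
  by_contra hadj
  have h₂ := hv (x (f a)) a b hab (hf a)
  have h₃ := hf' b (f a) fun h => hadj (G.symm _ _ h)
  simp_all

/-! ### Canonical valuations built from maps into the graphs. -/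

section Canonical

variable {Var : Type u} {V : Type w} (G : ℕ → FinGraph) (x : (n : ℕ) → Fin (G n).size → Var)
  (f : (n : ℕ) → V → Fin (G n).size) (S : Set ℕ)

open Classical in
/-- The valuation determined by a family of maps into the graphs `G n` for `n ∈ S`. -/
noncomputable def canonicalVal (p : Var) (a : V) : DM4 :=
  (decide (∃ n ∈ S, x n (f n a) = p), decide (∃ n ∈ S, ∃ b, x n b = p ∧ (G n).Adj b (f n a)))

variable {G x f S}

theorem canonicalVal_mem_upsets
    {R : V → V → Prop} (p : Var)
    (hf : ∀ n ∈ S, (∃ c, x n c = p) → ∀ a b, R a b → (G n).Adj (f n a) (f n b)) :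
    canonicalVal G x f S p ∈ upsets R := by
  intro a b hab h
  simp only [canonicalVal, decide_eq_true_eq] at h ⊢
  obtain ⟨n, hn, h⟩ := h
  exact ⟨n, hn, _, h, hf n hn ⟨_, h⟩ a b hab⟩

theorem eval_canonicalVal
    (hx : Function.Injective fun q : (n : ℕ) × Fin (G n).size => x q.1 q.2)
    {n : ℕ} (hn : n ∈ S) (hG : (G n).Admissible) (a : V) :
    ((G n).formula (x n)).eval (fun p => canonicalVal G x f S p a) = ⊤ := by
  have hinj : ∀ {m b c}, x m b = x n c → (⟨m, b⟩ : (n : ℕ) × Fin (G n).size) = ⟨n, c⟩ :=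
    fun {m b c} h => hx (a₁ := ⟨m, b⟩) (a₂ := ⟨n, c⟩) h
  rw [DM4.eq_top_iff, FinGraph.eval_formula_fst, FinGraph.eval_formula_snd]
  simp only [canonicalVal, decide_eq_true_eq, decide_eq_false_iff_not]
  -- The first coordinate is witnessed by the vertex `f n a` itself, the second by any neighbor `d`
  -- of it. This is where isolated vertices must be excluded.
  obtain ⟨d, hd⟩ := hG.2 (f n a)
  refine ⟨⟨f n a, ⟨n, hn, rfl⟩, ?_⟩, ⟨d, ⟨n, hn, d, rfl, (G n).symm _ _ hd⟩, ?_⟩⟩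
  · rintro b hb ⟨m, -, c, hc, hadj⟩
    cases hinj hc
    exact hb ((G n).symm _ _ hadj)
  · rintro b hb ⟨m, -, hc⟩
    have := hinj hc
    obtain rfl : m = n := congrArg Sigma.fst this
    cases hinj hc
    exact hb ((G m).symm _ _ hd)

end Canonical

/-! Substitutions. -/

theorem Fm.subst_subst {Var : Type u} (σ τ : Var → Fm Var) (φ : Fm Var) :
    (φ.subst σ).subst τ = φ.subst fun p => (σ p).subst τ := by
  induction φ <;> simp_all [Fm.subst]

theorem Fm.subst_var {Var : Type u} (φ : Fm Var) : φ.subst Fm.var = φ := by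
  induction φ <;> simp_all [Fm.subst]

theorem FinGraph.subst_formula_congr {Var : Type u} (G : FinGraph) (x : Fin G.size → Var)
    {σ τ : Var → Fm Var}
    (h : ∀ a, σ (x a) = τ (x a)) : (G.formula x).subst σ = (G.formula x).subst τ := by
  have hOr : ∀ (ρ : Var → Fm Var) (l : List (Fm Var)),
      (Fm.bigOr l).subst ρ = Fm.bigOr (l.map (Fm.subst ρ)) := by
    intro ρ l
    induction l <;> simp_all [Fm.bigOr, Fm.subst]
  have hAnd : ∀ (ρ : Var → Fm Var) (l : List (Fm Var)),
      (Fm.bigAnd l).subst ρ = Fm.bigAnd (l.map (Fm.subst ρ)) := by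
    intro ρ l
    induction l <;> simp_all [Fm.bigAnd, Fm.subst]
  simp [FinGraph.formula, hOr, hAnd, Fm.subst, Function.comp_def, h]

/-! Explosive extensions. -/

namespace Logic

variable {Var : Type u}

/-- Swapping coordinates is an automorphism of `DM4` which exchanges the two fixpoints, and `⊤` is
the only value designated both before and after the swap. -/
theorem BD_le_ETL : BD Var ≤ ETL Var := by
  intro Γ φ h v hv
  have hswap : ∀ ψ : Fm Var, ψ.eval (fun p => (v p).swap) = (ψ.eval v).swap := by
    intro ψ
    induction ψ <;> simp_all [Fm.eval, Prod.ext_iff, dneg]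
  refine (DM4.eq_top_iff _).2 ⟨h v fun γ hγ => ?_, ?_⟩
  · exact congrArg Prod.fst (hv γ hγ)
  · have := h (fun p => (v p).swap) fun γ hγ => ?_
    · rwa [hswap] at this
    · rw [hswap]
      exact congrArg Prod.snd (hv γ hγ)

theorem entails_of_mem (L : Logic Var) {Γ : Set (Fm Var)} {φ : Fm Var} (h : φ ∈ Γ) :
    L.Entails Γ φ := by
  have := L.mono {φ} Γ φ (L.refl φ)
  rwa [Set.union_eq_right.2 (Set.singleton_subset_iff.2 h)] at this

theorem le_extendBy (B : Logic Var) (ρ : Set (Set (Fm Var) × Fm Var)) : B ≤ B.extendBy ρ :=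
  fun Γ φ h _ hL => hL.1 Γ φ h

theorem extendBy_entails (B : Logic Var) {ρ : Set (Set (Fm Var) × Fm Var)}
    {r : Set (Fm Var) × Fm Var} (hr : r ∈ ρ) : (B.extendBy ρ).Entails r.1 r.2 :=
  fun _ hL => hL.2 r hr

theorem extendBy_le {B L : Logic Var} {ρ : Set (Set (Fm Var) × Fm Var)} (hB : B ≤ L)
    (hρ : ∀ r ∈ ρ, L.Entails r.1 r.2) : B.extendBy ρ ≤ L :=
  fun _ _ h => h L ⟨hB, hρ⟩

/-- The logic whose valid rules are those of `B` and those whose premises entail a substitution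
instance of `Δ` in `B`. -/
def withAntitheorem (B : Logic Var) (Δ : Set (Fm Var)) : Logic Var where
  Entails Γ φ := B.Entails Γ φ ∨ ∃ σ : Var → Fm Var, ∀ δ ∈ Δ, B.Entails Γ (δ.subst σ)
  refl φ := Or.inl (B.refl φ)
  mono Γ Γ' φ := by
    rintro (h | ⟨σ, h⟩)
    · exact Or.inl (B.mono _ _ _ h)
    · exact Or.inr ⟨σ, fun δ hδ => B.mono _ _ _ (h δ hδ)⟩
  cut Γ Γ' φ h := by
    -- Either `Γ` is already explosive, or each formula of `Γ'` follows from `Γ` in `B` itself.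
    by_cases hΓ : ∃ σ : Var → Fm Var, ∀ δ ∈ Δ, B.Entails Γ (δ.subst σ)
    · exact fun _ => Or.inr hΓ
    · replace h : ∀ δ ∈ Γ', B.Entails Γ δ := fun δ hδ => (h δ hδ).resolve_right hΓ
      rintro (h' | ⟨σ, h'⟩)
      · exact Or.inl (B.cut _ _ _ h h')
      · exact Or.inr ⟨σ, fun δ hδ => B.cut _ _ _ h (h' δ hδ)⟩
  structural Γ φ τ := by
    rintro (h | ⟨σ, h⟩)
    · exact Or.inl (B.structural _ _ _ h)
    · refine Or.inr ⟨fun p => (σ p).subst τ, fun δ hδ => ?_⟩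
      rw [← Fm.subst_subst]
      exact B.structural _ _ _ (h δ hδ)

theorem explosiveExtendBy_singleton_entails (B : Logic Var)
    (hB : ∀ φ, B.Entails {Fm.bot} φ) (Δ Γ : Set (Fm Var)) (φ : Fm Var) :
    (B.explosiveExtendBy {Δ}).Entails Γ φ ↔
      B.Entails Γ φ ∨ ∃ σ : Var → Fm Var, ∀ δ ∈ Δ, B.Entails Γ (δ.subst σ) := by
  constructor
  · refine extendBy_le (L := B.withAntitheorem Δ) (fun Γ φ h => Or.inl h) ?_ Γ φ
    rintro ⟨_, _⟩ ⟨rfl, rfl⟩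
    exact Or.inr ⟨Fm.var, fun δ hδ => by rw [Fm.subst_var]; exact B.entails_of_mem hδ⟩
  · rintro (h | ⟨σ, h⟩)
    · exact le_extendBy B _ Γ φ h
    · have hΔ : (B.explosiveExtendBy {Δ}).Entails Δ Fm.bot :=
        B.extendBy_entails (r := (Δ, Fm.bot)) ⟨rfl, rfl⟩
      refine cut _ _ (Fm.subst σ '' Δ) _ ?_ (cut _ _ {Fm.bot} _ ?_ (le_extendBy B _ _ _ (hB φ)))
      · rintro _ ⟨δ, hδ, rfl⟩
        exact le_extendBy B _ _ _ (h δ hδ)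
      · rintro _ rfl
        exact structural _ _ _ σ hΔ

theorem ETL_bot_entails (φ : Fm Var) : (ETL Var).Entails {Fm.bot} φ := by
  intro v hv
  have := hv _ rfl
  simp [Fm.eval] at this

end Logic

/-! ### Explosive rules given by families of graphs. -/

section Graphs

variable {Var : Type u} {G : ℕ → FinGraph} {x : (n : ℕ) → Fin (G n).size → Var}

open Logic

theorem explosiveExtendBy_range_formula
    (hx : Function.Injective fun q : (n : ℕ) × Fin (G n).size => x q.1 q.2) :
    (ETL Var).explosiveExtendBy {Set.range fun n => (G n).formula (x n)} =
      sInf (Set.range fun n => (ETL Var).explosiveExtendBy {{(G n).formula (x n)}}) := by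
  have hinf : ∀ Γ φ, (sInf (Set.range fun n =>
      (ETL Var).explosiveExtendBy {{(G n).formula (x n)}})).Entails Γ φ ↔
      ∀ n, ((ETL Var).explosiveExtendBy {{(G n).formula (x n)}}).Entails Γ φ :=
    fun Γ φ => Set.forall_mem_range
  ext Γ φ
  rw [hinf]
  simp only [explosiveExtendBy_singleton_entails _ ETL_bot_entails, Set.forall_mem_range,
    Set.mem_singleton_iff, forall_eq]
  constructor
  · rintro (h | ⟨σ, h⟩) n
    · exact Or.inl h
    · exact Or.inr ⟨σ, h n⟩
  · intro h
    by_cases hΓ : (ETL Var).Entails Γ φ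
    · exact Or.inl hΓ
    choose σ hσ using fun n => (h n).resolve_left hΓ
    classical
    -- Gluing: a variable which belongs to `G n` is substituted according to `σ n`; injectivity
    -- makes `n` unique.
    refine Or.inr ⟨fun p => if hp : ∃ q : (n : ℕ) × Fin (G n).size, x q.1 q.2 = p
      then σ hp.choose.1 p else Fm.var p, fun n => ?_⟩
    rw [FinGraph.subst_formula_congr (τ := σ n)]
    · exact hσ n
    · intro a
      have hp : ∃ q : (n : ℕ) × Fin (G n).size, x q.1 q.2 = x n a := ⟨⟨n, a⟩, rfl⟩
      rw [dif_pos hp, show hp.choose = ⟨n, a⟩ from hx hp.choose_spec]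

/-- Derivability of an instance of `φ_{G m}` from `φ_{G n}` for `n ∈ S` in `ETL` means that the
lower bounds of the graphs `G n` for `n ∈ S` lie below `G m`. -/
theorem homTo_of_ETL_entails (hG : ∀ n, (G n).Admissible)
    (hx : Function.Injective fun q : (n : ℕ) × Fin (G n).size => x q.1 q.2) {S : Set ℕ} {m : ℕ}
    {σ : Var → Fm Var}
    (h : (ETL Var).Entails ((fun n => (G n).formula (x n)) '' S) (((G m).formula (x m)).subst σ))
    {H : FinGraph} (hH : ∀ n ∈ S, H.HomTo (G n)) : H.HomTo (G m) := by
  have hf : ∀ n, ∃ f : Fin H.size → Fin (G n).size,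
      n ∈ S → ∀ a b, H.Adj a b → (G n).Adj (f a) (f b) := by
    intro n
    by_cases hn : n ∈ S
    · obtain ⟨f, hf⟩ := hH n hn
      exact ⟨f, fun _ => hf⟩
    -- Indices outside `S` are ignored by `canonicalVal`, so any map will do.
    · exact ⟨fun _ => ⟨0, (hG n).1⟩, fun h => absurd h hn⟩
  choose f hf using hf
  refine exists_hom_of_eval_formula (G m) (x m)
    (fun a q => (σ q).eval fun p => canonicalVal G x f S p a) (fun q => ?_) fun a => ?_
  · exact eval_mem_upsets H.symm
      (fun p => canonicalVal_mem_upsets p fun n hn _ => hf n hn) (σ q)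
  · rw [← Fm.eval_subst]
    refine h _ ?_
    rintro _ ⟨n, hn, rfl⟩
    exact eval_canonicalVal hx hn (hG n) a

theorem not_ETL_entails_bot (hG : ∀ n, (G n).Admissible)
    (hx : Function.Injective fun q : (n : ℕ) × Fin (G n).size => x q.1 q.2) (S : Set ℕ) :
    ¬ (ETL Var).Entails ((fun n => (G n).formula (x n)) '' S) Fm.bot := by
  intro h
  -- A single point suffices: without edges to respect, constant maps make all premises `⊤`.
  have := h (fun p => canonicalVal G x (fun n (_ : Unit) => ⟨0, (hG n).1⟩) S p ()) (by
    rintro _ ⟨n, hn, rfl⟩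
    exact eval_canonicalVal hx hn (hG n) ())
  simp [Fm.eval] at this

theorem NoFiniteSubfamily.exists_not_homTo (hG : NoFiniteSubfamily G) {S : Set ℕ}
    (hS : S.Finite) :
    ∃ (H : FinGraph) (m : ℕ), 0 < H.size ∧ (∀ n ∈ S, H.HomTo (G n)) ∧ ¬ H.HomTo (G m) := by
  by_contra! hcon
  refine hG.2 S hS (Set.Subset.antisymm ?_ ?_)
  · rintro H ⟨h₀, hH⟩
    refine ⟨h₀, ?_⟩
    rintro _ ⟨m, rfl⟩
    exact hcon H m h₀ fun n hn => hH _ ⟨n, hn, rfl⟩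
  · rintro H ⟨h₀, hH⟩
    refine ⟨h₀, ?_⟩
    rintro _ ⟨n, -, rfl⟩
    exact hH _ ⟨n, rfl⟩

theorem not_isFinitary_of_noFiniteSubfamily (hG : NoFiniteSubfamily G)
    (hx : Function.Injective fun q : (n : ℕ) × Fin (G n).size => x q.1 q.2) :
    ¬ ((ETL Var).explosiveExtendBy {Set.range fun n => (G n).formula (x n)}).IsFinitary := by
  intro hfin
  have hΓ := hfin (Set.range fun n => (G n).formula (x n)) Fm.bot
    (extendBy_entails _ (r := (Set.range fun n => (G n).formula (x n), Fm.bot)) ⟨rfl, rfl⟩)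
  rw [← Set.image_univ, Set.exists_subset_image_finite_and, Set.image_univ] at hΓ
  obtain ⟨S, -, hS, h⟩ := hΓ
  rw [explosiveExtendBy_singleton_entails _ ETL_bot_entails] at h
  rcases h with h | ⟨σ, h⟩
  · exact not_ETL_entails_bot hG.1 hx S h
  · obtain ⟨H, m, -, hH, hHm⟩ := hG.exists_not_homTo hS
    exact hHm (homTo_of_ETL_entails hG.1 hx (h _ ⟨m, rfl⟩) hH)

end Graphs

/-! Odd cycles. -/

/-- The cycle with `2 * n + 3` vertices. -/
def oddCycle (n : ℕ) : FinGraph where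
  size := 2 * n + 3
  Adj a b := (b : ℕ) = a + 1 ∨ (a : ℕ) = b + 1 ∨ ((a : ℕ) = 0 ∧ (b : ℕ) = 2 * n + 2) ∨
    ((b : ℕ) = 0 ∧ (a : ℕ) = 2 * n + 2)
  symm a b h := by omega

theorem oddCycle_homTo {n m : ℕ} (h : n ≤ m) : (oddCycle m).HomTo (oddCycle n) := by
  -- The surplus vertices, even in number, are folded onto the edge between `0` and `1`, ending at
  -- `1`, which is adjacent to the image of `0`.
  refine ⟨fun a => ⟨if (a : ℕ) < 2 * n + 3 then a else (a - (2 * n + 3)) % 2, ?_⟩, ?_⟩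
  · show _ < 2 * n + 3
    split_ifs <;> omega
  · rintro ⟨a, ha⟩ ⟨b, hb⟩ hab
    simp only [oddCycle] at ha hb hab ⊢
    split_ifs <;> omega

/-- Here `s` counts the steps down among the first `i` steps of a walk modulo `M`. -/
theorem exists_dvd_of_steps {M : ℤ} {g : ℕ → ℤ} {k : ℕ}
    (hg : ∀ i < k, M ∣ g (i + 1) - g i - 1 ∨ M ∣ g (i + 1) - g i + 1) :
    ∀ i ≤ k, ∃ s : ℤ, 0 ≤ s ∧ s ≤ i ∧ M ∣ g i - g 0 - i + 2 * s := by
  intro i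
  induction i with
  | zero => exact fun _ => ⟨0, by simp⟩
  | succ i ih =>
    intro hi
    obtain ⟨s, hs, hsi, hk⟩ := ih (by omega)
    rcases hg i (by omega) with h | h
    · refine ⟨s, hs, by omega, (dvd_add hk h).trans (dvd_of_eq ?_)⟩
      push_cast
      ring
    · refine ⟨s + 1, by omega, by omega, (dvd_add hk h).trans (dvd_of_eq ?_)⟩
      push_cast
      ring

theorem not_oddCycle_homTo {n m : ℕ} (h : n < m) : ¬ (oddCycle n).HomTo (oddCycle m) := by
  rintro ⟨f, hf⟩
  -- The closed walk once around the short cycle; the value `0` at `2 * n + 3` closes it.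
  let c : ℕ → Fin (oddCycle n).size := fun i =>
    ⟨if i < 2 * n + 3 then i else 0, by simp only [oddCycle]; split_ifs <;> omega⟩
  have hstep : ∀ a b : ℕ, b = a + 1 ∨ a = b + 1 ∨ (a = 0 ∧ b = 2 * m + 2) ∨
      (b = 0 ∧ a = 2 * m + 2) → (2 * m + 3 : ℤ) ∣ (b : ℤ) - a - 1 ∨
      (2 * m + 3 : ℤ) ∣ (b : ℤ) - a + 1 := by
    rintro a b (rfl | rfl | ⟨rfl, rfl⟩ | ⟨rfl, rfl⟩)
    · exact Or.inl ⟨0, by push_cast; ring⟩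
    · exact Or.inr ⟨0, by push_cast; ring⟩
    · exact Or.inr ⟨1, by push_cast; ring⟩
    · exact Or.inl ⟨-1, by push_cast; ring⟩
  have hadj : ∀ i < 2 * n + 3, (oddCycle n).Adj (c i) (c (i + 1)) := by
    intro i hi
    simp only [oddCycle, c]
    split_ifs <;> omega
  obtain ⟨s, hs, hsn, hdvd⟩ := exists_dvd_of_steps (g := fun i => ((f (c i) : ℕ) : ℤ))
    (fun i hi => hstep _ _ (hf _ _ (hadj i hi))) (2 * n + 3) le_rfl
  have hc : c (2 * n + 3) = c 0 := by simp [c]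
  simp only [hc, sub_self] at hdvd
  push_cast at hdvd hsn
  -- The net displacement is at most `2 * n + 3 < 2 * m + 3` in absolute value, so it vanishes, yet
  -- it is odd.
  have := Int.eq_zero_of_abs_lt_dvd hdvd (by rw [abs_lt]; constructor <;> omega)
  omega

theorem noFiniteSubfamily_oddCycle : NoFiniteSubfamily oddCycle := by
  refine ⟨fun n => ⟨by simp [oddCycle], fun a => ?_⟩, fun S hS h => ?_⟩
  · rcases Nat.eq_zero_or_pos (a : ℕ) with ha | ha
    · exact ⟨⟨1, by simp [oddCycle]⟩, Or.inl (by simp [ha])⟩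
    · exact ⟨⟨a - 1, by omega⟩, Or.inr (Or.inl (by simp only; omega))⟩
  · obtain ⟨N, hN⟩ := hS.bddAbove
    have hmem : oddCycle N ∈ FinGraph.lowerBounds (oddCycle '' S) := by
      refine ⟨by simp [oddCycle], ?_⟩
      rintro _ ⟨n, hn, rfl⟩
      exact oddCycle_homTo (hN hn)
    rw [h] at hmem
    exact not_oddCycle_homTo (Nat.lt_succ_self N) (hmem.2 _ ⟨N + 1, rfl⟩)

/-! Classes of De Morgan algebras. -/

section Classes

variable {G : ℕ → FinGraph} {x : (n : ℕ) → Fin (G n).size → ℕ}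

/-- The equations `φ_{G n} ≈ ⊤`. -/
def formulaEquations (G : ℕ → FinGraph) (x : (n : ℕ) → Fin (G n).size → ℕ) : Set Equation :=
  Set.range fun n => ((G n).formula (x n), Fm.top)

/-- The vertices of the product of the graphs `G n`, lifted to the universe `w`. -/
abbrev ProdVertex (G : ℕ → FinGraph) : Type w := ULift.{w} (∀ n, Fin (G n).size)

/-- The edges of the product of the first graphs in the sequence `G`. -/
def partialAdj (G : ℕ → FinGraph) (n : ℕ) (a b : ProdVertex.{w} G) : Prop :=
  ∀ i ≤ n, (G i).Adj (a.down i) (b.down i)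

theorem partialAdj_symm (n : ℕ) (a b : ProdVertex.{w} G) (h : partialAdj G n a b) :
    partialAdj G n b a := fun i hi => (G i).symm _ _ (h i hi)

theorem upsets_partialAdj_mono : Monotone fun n => upsets (partialAdj.{w} G n) :=
  fun _ _ hnm _ hs a b hab => hs a b fun i hi => hab i (hi.trans hnm)

theorem isSubalgebra_partial (n : ℕ) : IsSubalgebra (upsets (partialAdj.{w} G n)) :=
  isSubalgebra_upsets (partialAdj_symm n)

theorem isSubalgebra_limit : IsSubalgebra (⋃ n, upsets (partialAdj.{w} G n)) :=
  isSubalgebra_iUnion isSubalgebra_partial upsets_partialAdj_mono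

theorem not_holds_partial (hG : NoFiniteSubfamily G) (n : ℕ)
    (v : ℕ → upsets (partialAdj.{w} G n)) :
    letI := (isSubalgebra_partial.{w} (G := G) n).algebra
    ∃ e ∈ formulaEquations G x, ¬ e.Holds v := by
  let := (isSubalgebra_partial.{w} (G := G) n).algebra
  by_contra! hcon
  obtain ⟨H, m, -, hH, hm⟩ := hG.exists_not_homTo (Set.finite_Iic n)
  obtain ⟨g, hg⟩ := exists_hom_of_eval_formula (G m) (x m) (fun a p => (v p).1 a)
    (fun p => (v p).2) (((isSubalgebra_partial n).holds_iff v _).1 (hcon _ ⟨m, rfl⟩))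
  have hf : ∀ i, ∃ f : Fin H.size → Fin (G i).size,
      i ≤ n → ∀ a b, H.Adj a b → (G i).Adj (f a) (f b) := by
    intro i
    by_cases hi : i ≤ n
    · obtain ⟨f, hf⟩ := hH i hi
      exact ⟨f, fun _ => hf⟩
    -- Coordinates beyond `n` do not constrain the edges of stage `n`, so `H` still maps into it,
    -- and then through `g` into `G m`.
    · exact ⟨fun _ => ⟨0, (hG.1 i).1⟩, fun h => absurd h hi⟩
  choose f hf using hf
  exact hm ⟨fun a => g ⟨fun i => f i a⟩, fun a b hab => hg _ _ fun i hi => hf i hi a b hab⟩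

/-- A variable of `G n` only needs edges to respect coordinate `n`, so its canonical value lies in
stage `n`. A single stage need not contain the values of all variables, but the union does. -/
theorem exists_holds_limit (hG : ∀ n, (G n).Admissible)
    (hx : Function.Injective fun q : (n : ℕ) × Fin (G n).size => x q.1 q.2) :
    letI := (isSubalgebra_limit.{w} (G := G)).algebra
    ∃ v : ℕ → ⋃ n, upsets (partialAdj.{w} G n), ∀ e ∈ formulaEquations G x, e.Holds v := by
  let := (isSubalgebra_limit.{w} (G := G)).algebra
  let f : (n : ℕ) → ProdVertex.{w} G → Fin (G n).size := fun n a => a.down n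
  have hmem : ∀ p, canonicalVal G x f Set.univ p ∈ ⋃ n, upsets (partialAdj.{w} G n) := by
    intro p
    by_cases hp : ∃ (n : ℕ) (c : Fin (G n).size), x n c = p
    · obtain ⟨n, c, rfl⟩ := hp
      refine Set.mem_iUnion.2 ⟨n, canonicalVal_mem_upsets _ fun m _ ⟨d, hd⟩ a b hab => ?_⟩
      have : (⟨m, d⟩ : (n : ℕ) × Fin (G n).size) = ⟨n, c⟩ := hx hd
      exact hab m (congrArg Sigma.fst this).le
    · exact Set.mem_iUnion.2 ⟨0, canonicalVal_mem_upsets p fun m _ hm => absurd ⟨m, hm⟩ hp⟩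
  refine ⟨fun p => ⟨_, hmem p⟩, ?_⟩
  rintro _ ⟨n, rfl⟩
  rw [isSubalgebra_limit.holds_iff]
  exact eval_canonicalVal hx (Set.mem_univ n) (hG n)

/-- The union of the increasing sequence of algebras is locally approximated by these algebras. -/
theorem exists_valuation_partial (E : Finset Equation)
    (v : ℕ → ⋃ n, upsets (partialAdj.{w} G n)) :
    ∃ (n : ℕ) (v' : ℕ → upsets (partialAdj.{w} G n)), ∀ e ∈ E,
      (@Equation.Holds _ (isSubalgebra_partial n).algebra v' e ↔
        @Equation.Holds _ isSubalgebra_limit.algebra v e) := by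
  obtain ⟨N, hN⟩ := exists_holds_congr.{0} E
  choose k hk using fun p => Set.mem_iUnion.1 (v p).2
  -- A stage which contains the values of all variables occurring in `E`; the other variables get
  -- the irrelevant value `⊤`.
  let n := (Finset.range N).sup k
  have hn : ∀ p < N, (v p).1 ∈ upsets (partialAdj.{w} G n) := fun p hp =>
    upsets_partialAdj_mono (Finset.le_sup (f := k) (Finset.mem_range.2 hp)) (hk p)
  refine ⟨n, fun p => if hp : p < N then ⟨_, hn p hp⟩ else ⟨_, (isSubalgebra_partial n).top⟩,
    fun e he => ?_⟩
  rw [IsSubalgebra.holds_iff, IsSubalgebra.holds_iff]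
  exact forall_congr' fun u => hN DM4 _ _ _ (fun p hp => by simp [hp]) e he

theorem not_isAntivariety (hG : NoFiniteSubfamily G)
    (hx : Function.Injective fun q : (n : ℕ) × Fin (G n).size => x q.1 q.2) :
    ¬ IsAntivariety (negClauseClass.{w} (formulaEquations G x)) := by
  rintro ⟨T, hT⟩
  obtain ⟨v, hv⟩ := exists_holds_limit.{w} hG.1 hx
  have hlim := (hT _ (isSubalgebra_limit.{w} (G := G)).algebra).not.1 fun h => by
    obtain ⟨e, he, hev⟩ := h v
    exact hev (hv e he)
  simp only [SatNegClause, not_forall, not_exists, not_and, not_not] at hlim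
  obtain ⟨E, hE, v, hv⟩ := hlim
  obtain ⟨n, v', hv'⟩ := exists_valuation_partial E v
  obtain ⟨e, he, hev⟩ := (hT _ (isSubalgebra_partial.{w} (G := G) n).algebra).1
    (not_holds_partial hG n) E hE v'
  exact hev ((hv' e he).2 (hv e he))

/-- The class of De Morgan algebras which satisfy the infinitary quasiequation with the
premises `E` and the conclusion `⊤ ≈ ⊥`. -/
def explosiveClass (E : Set Equation) : DMClass.{w} := fun A _ =>
  ∀ v : ℕ → A, (∀ e ∈ E, e.Holds v) → (⊤ : A) = ⊥

theorem isPrevariety_explosiveClass (E : Set Equation) : IsPrevariety (explosiveClass.{w} E) where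
  embed A B hA hB f hf hinj hC v hv := by
    refine hinj ?_
    rw [hf.map_top, hf.map_bot]
    refine hC (fun p => f (v p)) fun e he => ?_
    rw [Equation.Holds, ← hf.eval, ← hf.eval, hv e he]
  prod I A hA hC v hv := by
    funext i
    refine hC i (fun p => v p i) fun e he => ?_
    rw [Equation.Holds, ← Fm.eval_pi, ← Fm.eval_pi, hv e he]

theorem not_isQuasivariety (hG : NoFiniteSubfamily G)
    (hx : Function.Injective fun q : (n : ℕ) × Fin (G n).size => x q.1 q.2) :
    ¬ IsQuasivariety (explosiveClass.{w} (formulaEquations G x)) := by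
  classical
  rintro ⟨T, hT⟩
  obtain ⟨v, hv⟩ := exists_holds_limit.{w} hG.1 hx
  have hlim := (hT _ (isSubalgebra_limit.{w} (G := G)).algebra).not.1 fun h => by
    -- The union is non-trivial, since the product of the vertex sets has a point.
    have := congrFun (congrArg Subtype.val (h v hv)) ⟨fun n => ⟨0, (hG.1 n).1⟩⟩
    exact Bool.noConfusion (congrArg Prod.fst this)
  simp only [SatQuasiEq, not_forall] at hlim
  obtain ⟨r, hr, v, hv, hvr⟩ := hlim
  -- The conclusion is transferred together with the premises, so that its failure passes to the
  -- stage too. The stage belongs to the class vacuously.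
  obtain ⟨n, v', hv'⟩ := exists_valuation_partial (insert r.2 r.1) v
  refine hvr ((hv' _ (Finset.mem_insert_self _ _)).1 ?_)
  refine (hT _ (isSubalgebra_partial.{w} (G := G) n).algebra).1 (fun v'' hv'' => ?_) r hr v'
    fun e he => (hv' e (Finset.mem_insert_of_mem he)).2 (hv e he)
  obtain ⟨e, he, hev⟩ := not_holds_partial (x := x) hG n v''
  exact absurd (hv'' e he) hev

end Classes

/-- The vertices of countably many graphs may be assigned distinct variables. -/
theorem exists_injective_variables (Var : Type u) [Infinite Var] (G : ℕ → FinGraph) :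
    ∃ x : (n : ℕ) → Fin (G n).size → Var,
      Function.Injective fun q : (n : ℕ) × Fin (G n).size => x q.1 q.2 := by
  obtain ⟨g, hg⟩ := exists_injective_nat ((n : ℕ) × Fin (G n).size)
  exact ⟨fun n a => Infinite.natEmbedding Var (g ⟨n, a⟩),
    (Infinite.natEmbedding Var).injective.comp hg⟩

end SuperBelnap

theorem mainTheorem3 (Var : Type u) [Infinite Var] :
    -- a non-finitary explosive extension of ETL, which is moreover a super-Belnap logic
    (∃ L : SuperBelnap.Logic Var,
      SuperBelnap.Logic.BD Var ≤ L ∧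
      SuperBelnap.Logic.IsExplosiveExtension (SuperBelnap.Logic.ETL Var) L ∧
      ¬ L.IsFinitary) ∧
    -- there is a countable family of graphs no finite subfamily of which has the same lower bounds
    (∃ G : ℕ → SuperBelnap.FinGraph, SuperBelnap.NoFiniteSubfamily G) ∧
    -- each such family yields a non-finitary explosive extension of ETL
    (∀ G : ℕ → SuperBelnap.FinGraph, SuperBelnap.NoFiniteSubfamily G →
      ∀ x : (n : ℕ) → Fin (G n).size → Var,
        Function.Injective (fun q : (n : ℕ) × Fin (G n).size => x q.1 q.2) →
        (SuperBelnap.Logic.ETL Var).explosiveExtendBy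
            {Set.range fun n => (G n).formula (x n)} =
          sInf (Set.range fun n =>
            (SuperBelnap.Logic.ETL Var).explosiveExtendBy {{(G n).formula (x n)}}) ∧
        ¬ ((SuperBelnap.Logic.ETL Var).explosiveExtendBy
            {Set.range fun n => (G n).formula (x n)}).IsFinitary) ∧
    -- an infinitary negative clause whose class of De Morgan algebras is not an antivariety
    (∃ E : Set SuperBelnap.Equation,
      ¬ SuperBelnap.IsAntivariety (SuperBelnap.negClauseClass.{w} E)) ∧
    -- a prevariety of De Morgan algebras which is not a quasivariety
    (∃ C : SuperBelnap.DMClass.{w},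
      SuperBelnap.IsPrevariety C ∧ ¬ SuperBelnap.IsQuasivariety C) := by
  have hodd := SuperBelnap.noFiniteSubfamily_oddCycle
  obtain ⟨x, hx⟩ := SuperBelnap.exists_injective_variables Var SuperBelnap.oddCycle
  obtain ⟨y, hy⟩ := SuperBelnap.exists_injective_variables ℕ SuperBelnap.oddCycle
  refine ⟨⟨_, fun Γ φ h => ?_, ⟨_, rfl⟩, SuperBelnap.not_isFinitary_of_noFiniteSubfamily hodd hx⟩,
    ⟨_, hodd⟩,
    fun G hG x hx => ⟨SuperBelnap.explosiveExtendBy_range_formula hx,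
      SuperBelnap.not_isFinitary_of_noFiniteSubfamily hG hx⟩,
    ⟨_, SuperBelnap.not_isAntivariety hodd hy⟩,
    ⟨_, SuperBelnap.isPrevariety_explosiveClass _, SuperBelnap.not_isQuasivariety hodd hy⟩⟩
  exact SuperBelnap.Logic.le_extendBy _ _ Γ φ (SuperBelnap.Logic.BD_le_ETL Γ φ h)
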